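/- Notation: $\mathbb{Z}^+=\{0,1,2,\dots\}$, $\mathbb{R}^+=[0,\infty)$. $K_\infty$ is the class of continuous, strictly increasing, unbounded functions $a:\mathbb{R}^+\to\mathbb{R}^+$ with $a(0)=0$; $K^+$ is the class of continuous positive functions on $\mathbb{R}^+$. Let $\mathcal X,\mathcal Y$ be real normed linear spaces with norms $\|\cdot\|$, $D$ a set, $f:\mathbb{Z}^+\times D\times\mathcal X\to\mathcal X$ and $H:\mathbb{Z}^+\times\mathcal X\to\mathcal Y$. $M_D$ is the set of sequences $d=(d(0),d(1),\dots)$ in $D$. For $d\in M_D$ and $(t_0,x_0)\in\mathbb{Z}^+\times\mathcal X$ let $x(t)$, $t\ge t_0$, be the solution of $$x(t+1)=f(t,d(t),x(t)),\qquad Y(t)=H(t,x(t)),\qquad x(t_0)=x_0. \tag{$*$}$$ A map $G:\mathbb{Z}^+\times\mathcal X\to\mathcal W$ into a normed space is in $CU(\mathbb{Z}^+\times\mathcal X;\mathcal W)$ if it is continuous and for all bounded $I\subset\mathbb{Z}^+$, $S\subset\mathcal X$ and every $\varepsilon>0$ the set $G(I\times S)$ is bounded and there is $\delta>0$ such that $\|G(t,x)-G(t,x_0)\|<\varepsilon$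 for all $t\in I$ and $x,x_0\in S$ with $\|x-x_0\|<\delta$. $CU(\mathbb{Z}^+\times\mathcal X;\mathbb{R}^+)$ is the set of such real-valued maps with values in $\mathbb{R}^+$. Hypotheses: * (H1) There are $a\in K_\infty$, $\beta\in K^+$ with $\|f(t,d,x)\|\le a(\beta(t)\|x\|)$ for all $(t,d,x)\in\mathbb{Z}^+\times D\times\mathcal X$. * (H2) For all bounded $I\subset\mathbb{Z}^+$, $S\subset\mathcal X$ and every $\varepsilon>0$ the set $H(I\times S)$ is bounded and there is $\delta>0$ such that $\|H(t,x)-H(t,x_0)\|<\varepsilon$ for all $t\in I$ and $x,x_0\in S$ with $\|x-x_0\|<\delta$; moreover $H(t,0)=0$ for all $t\in\mathbb{Z}^+$. * (H3) For all bounded $S\subset\mathcal X$, $I\subset\mathbb{Z}^+$ and every $\varepsilon>0$ the set $f(I\times D\times S)$ is bounded and there is $\delta>0$ such that $\|f(t,d,x)-f(t,d,x_0)\|<\varepsilon$ for all $d\in D$, $t\in I$ and $x,x_0\in S$ with $\|x-x_0\|<\delta$; moreover $f(t,d,0)=0$ for all $(t,d)\in\mathbb{Z}^+\times D$. System $(*)$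 is non-uniformly in time Robustly Globally Asymptotically Output Stable (RGAOS) if * (P1) for all $\varepsilon>0$, $T\in\mathbb{Z}^+$: $\sup\{\|H(t,x(t))\| : t\ge t_0,\ \|x_0\|\le\varepsilon,\ t_0\in[0,T],\ d\in M_D\}<+\infty$, and there is $\delta=\delta(\varepsilon,T)>0$ such that $\|x_0\|\le\delta$, $t_0\in[0,T]$ imply $\|H(t,x(t))\|\le\varepsilon$ for all $t\ge t_0$ and all $d\in M_D$; * (P2) for all $\varepsilon>0$, $T\in\mathbb{Z}^+$, $R\ge0$ there is $\tau=\tau(\varepsilon,T,R)\in\mathbb{Z}^+$ such that $\|x_0\|\le R$, $t_0\in[0,T]$ imply $\|H(t,x(t))\|\le\varepsilon$ for all $t\ge t_0+\tau$ and all $d\in M_D$. **Proposition.** Assume (H1) and (H2). Then the following are equivalent: 1. System $(*)$ is non-uniformly in time RGAOS. 2. There are $V:\mathbb{Z}^+\times\mathcal X\to\mathbb{R}^+$, $a_1,a_2\in K_\infty$, $\beta,\mu\in K^+$ and $\lambda\in(0,1)$ such that, for all $(t,x,d)\in\mathbb{Z}^+\times\mathcal X\times D$, $$a_1(\|H(t,x)\|+\mu(t)\|x\|)\le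 V(t,x)\le a_2(\beta(t)\|x\|),\qquad V(t+1,f(t,d,x))\le\lambda V(t,x).$$ 3. There are $V:\mathbb{Z}^+\times\mathcal X\to\mathbb{R}^+$, $a_1,a_2,a_3\in K_\infty$ with $a_3(s)\le s$ for all $s\ge0$, $\beta\in K^+$ and a continuous $q:\mathbb{R}^+\to\mathbb{R}^+$ with $\lim_{t\to+\infty}q(t)=0$ such that, for all $(t,x,d)\in\mathbb{Z}^+\times\mathcal X\times D$, $$a_1(\|H(t,x)\|)\le V(t,x)\le a_2(\beta(t)\|x\|),\qquad V(t+1,f(t,d,x))\le V(t,x)-a_3(V(t,x))+q(t).$$ Moreover, if in addition (H3) holds, then $V$ in statement 2 can be chosen in $CU(\mathbb{Z}^+\times\mathcal X;\mathbb{R}^+)$; that is, $(*)$ is non-uniformly in time RGAOS if and only if statement 2 holds with some $V\in CU(\mathbb{Z}^+\times\mathcal X;\mathbb{R}^+)$. -/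

import Mathlib

open Set Filter Topology

namespace OutputStability

/-- Class `K_∞`: functions `[0, ∞) → [0, ∞)` that are continuous, strictly increasing, zero at zero
and unbounded. Only the values on `[0, ∞)` matter. -/
structure ClassKInf (a : ℝ → ℝ) : Prop where
  continuousOn : ContinuousOn a (Ici 0)
  strictMonoOn : StrictMonoOn a (Ici 0)
  map_zero : a 0 = 0
  tendsto_atTop : Tendsto a atTop atTop

/-- Class `K⁺`: continuous positive functions on `[0, ∞)`. Only the values on `[0, ∞)` matter. -/
structure ClassKPlus (b : ℝ → ℝ) : Prop where
  continuousOn : ContinuousOn b (Ici 0)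
  pos : ∀ t : ℝ, 0 ≤ t → 0 < b t

section Regularity

variable {X Y D : Type*} [NormedAddCommGroup X] [NormedAddCommGroup Y]

/-- A time-varying map is bounded and uniformly continuous in the state on bounded sets of times
and states. -/
def RegularOnBounded (H : ℕ → X → Y) : Prop :=
  ∀ (I : Set ℕ) (S : Set X), Bornology.IsBounded I → Bornology.IsBounded S → ∀ ε : ℝ, 0 < ε →
    Bornology.IsBounded {y : Y | ∃ t ∈ I, ∃ x ∈ S, y = H t x} ∧
    ∃ δ : ℝ, 0 < δ ∧ ∀ t ∈ I, ∀ x ∈ S, ∀ x₀ ∈ S, ‖x - x₀‖ < δ → ‖H t x - H t x₀‖ < ε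

/-- The class `CU(Z⁺ × X; Y)`. -/
def ClassCU (H : ℕ → X → Y) : Prop :=
  Continuous (fun p : ℕ × X => H p.1 p.2) ∧ RegularOnBounded H

/-- Growth hypothesis on the dynamics: `‖f(t,d,x)‖ ≤ a(β(t)‖x‖)` with `a ∈ K_∞`, `β ∈ K⁺`. -/
def GrowthHypothesis (f : ℕ → D → X → X) : Prop :=
  ∃ a β : ℝ → ℝ, ClassKInf a ∧ ClassKPlus β ∧ ∀ (t : ℕ) (d : D) (x : X), ‖f t d x‖ ≤ a (β t * ‖x‖)

/-- Hypothesis on the output map. -/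
def OutputHypothesis (H : ℕ → X → Y) : Prop :=
  RegularOnBounded H ∧ ∀ t : ℕ, H t 0 = 0

/-- Continuity hypothesis on the dynamics: bounded, and uniformly continuous in the state uniformly
in the disturbance, on bounded sets, with `f(t,d,0) = 0`. -/
def ContinuityHypothesis (f : ℕ → D → X → X) : Prop :=
  (∀ (S : Set X) (I : Set ℕ), Bornology.IsBounded S → Bornology.IsBounded I → ∀ ε : ℝ, 0 < ε →
    Bornology.IsBounded {y : X | ∃ t ∈ I, ∃ d : D, ∃ x ∈ S, y = f t d x} ∧
    ∃ δ : ℝ, 0 < δ ∧ ∀ t ∈ I, ∀ x ∈ S, ∀ x₀ ∈ S, ‖x - x₀‖ < δ →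
      ∀ d : D, ‖f t d x - f t d x₀‖ < ε) ∧
  ∀ (t : ℕ) (d : D), f t d 0 = 0

end Regularity

section Solutions

variable {X D : Type*}

/-- The solution of `x(t+1) = f(t, d(t), x(t))` with `x(t₀) = x₀`, as a function of `t`;
it is only meaningful for `t ≥ t₀` (and is set to `x₀` before `t₀`). -/
def solution (f : ℕ → D → X → X) (d : ℕ → D) (t₀ : ℕ) (x₀ : X) : ℕ → X
  | 0 => x₀
  | t + 1 => if t₀ ≤ t then f t (d t) (solution f d t₀ x₀ t) else x₀

theorem solution_of_le (f : ℕ → D → X → X) (d : ℕ → D) (t₀ : ℕ) (x₀ : X) :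
    ∀ t : ℕ, t ≤ t₀ → solution f d t₀ x₀ t = x₀
  | 0, _ => rfl
  | t + 1, h => by
    have h' : ¬ t₀ ≤ t := by omega
    simp [solution, h']

theorem solution_initial (f : ℕ → D → X → X) (d : ℕ → D) (t₀ : ℕ) (x₀ : X) :
    solution f d t₀ x₀ t₀ = x₀ :=
  solution_of_le f d t₀ x₀ t₀ le_rfl

theorem solution_succ (f : ℕ → D → X → X) (d : ℕ → D) (t₀ : ℕ) (x₀ : X) (t : ℕ) (h : t₀ ≤ t) :
    solution f d t₀ x₀ (t + 1) = f t (d t) (solution f d t₀ x₀ t) := by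
  simp [solution, h]

end Solutions

section Stability

variable {X Y D : Type*} [NormedAddCommGroup X] [NormedAddCommGroup Y]

/-- Robust Output Stability. -/
def RobustOutputStability (f : ℕ → D → X → X) (H : ℕ → X → Y) : Prop :=
  ∀ (ε : ℝ) (T : ℕ), 0 < ε →
    BddAbove {r : ℝ | ∃ (t t₀ : ℕ) (x₀ : X) (d : ℕ → D), t₀ ≤ t ∧ ‖x₀‖ ≤ ε ∧ t₀ ≤ T ∧
      r = ‖H t (solution f d t₀ x₀ t)‖} ∧
    ∃ δ : ℝ, 0 < δ ∧ ∀ (x₀ : X) (t₀ : ℕ), ‖x₀‖ ≤ δ → t₀ ≤ T →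
      ∀ t : ℕ, t₀ ≤ t → ∀ d : ℕ → D, ‖H t (solution f d t₀ x₀ t)‖ ≤ ε

/-- Robust Output Attractivity. -/
def RobustOutputAttractivity (f : ℕ → D → X → X) (H : ℕ → X → Y) : Prop :=
  ∀ (ε : ℝ) (T : ℕ) (R : ℝ), 0 < ε → 0 ≤ R →
    ∃ τ : ℕ, ∀ (x₀ : X) (t₀ : ℕ), ‖x₀‖ ≤ R → t₀ ≤ T →
      ∀ t : ℕ, t₀ + τ ≤ t → ∀ d : ℕ → D, ‖H t (solution f d t₀ x₀ t)‖ ≤ ε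

/-- Non-uniform in time Robust Global Asymptotic Output Stability. -/
def RGAOS (f : ℕ → D → X → X) (H : ℕ → X → Y) : Prop :=
  RobustOutputStability f H ∧ RobustOutputAttractivity f H

/-- `V : Z⁺ × X → [0, ∞)` satisfies
`a₁(‖H(t,x)‖ + μ(t)‖x‖) ≤ V(t,x) ≤ a₂(β(t)‖x‖)` and `V(t+1, f(t,d,x)) ≤ c V(t,x)`
for some `a₁, a₂ ∈ K_∞`, `β, μ ∈ K⁺` and `c ∈ (0,1)`. -/
def GeometricLyapunov (f : ℕ → D → X → X) (H : ℕ → X → Y) (V : ℕ → X → ℝ) : Prop :=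
  (∀ t x, 0 ≤ V t x) ∧
  ∃ (a₁ a₂ β μ : ℝ → ℝ) (c : ℝ),
    ClassKInf a₁ ∧ ClassKInf a₂ ∧ ClassKPlus β ∧ ClassKPlus μ ∧ 0 < c ∧ c < 1 ∧
    (∀ (t : ℕ) (x : X), a₁ (‖H t x‖ + μ t * ‖x‖) ≤ V t x ∧ V t x ≤ a₂ (β t * ‖x‖)) ∧
    ∀ (t : ℕ) (x : X) (d : D), V (t + 1) (f t d x) ≤ c * V t x

/-- `V : Z⁺ × X → [0, ∞)` satisfies `a₁(‖H(t,x)‖) ≤ V(t,x) ≤ a₂(β(t)‖x‖)` and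
`V(t+1, f(t,d,x)) ≤ V(t,x) - a₃(V(t,x)) + q(t)` for some `a₁, a₂, a₃ ∈ K_∞` with `a₃(s) ≤ s`,
some `β ∈ K⁺` and some continuous `q : [0, ∞) → [0, ∞)` with `q(t) → 0`. -/
def PerturbedLyapunov (f : ℕ → D → X → X) (H : ℕ → X → Y) (V : ℕ → X → ℝ) : Prop :=
  (∀ t x, 0 ≤ V t x) ∧
  ∃ a₁ a₂ a₃ β q : ℝ → ℝ,
    ClassKInf a₁ ∧ ClassKInf a₂ ∧ ClassKInf a₃ ∧ (∀ s : ℝ, 0 ≤ s → a₃ s ≤ s) ∧ ClassKPlus β ∧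
    ContinuousOn q (Ici 0) ∧ (∀ t : ℝ, 0 ≤ t → 0 ≤ q t) ∧ Tendsto q atTop (𝓝 0) ∧
    (∀ (t : ℕ) (x : X), a₁ ‖H t x‖ ≤ V t x ∧ V t x ≤ a₂ (β t * ‖x‖)) ∧
    ∀ (t : ℕ) (x : X) (d : D), V (t + 1) (f t d x) ≤ V t x - a₃ (V t x) + q t

end Stability

end OutputStability

/-!
Under the growth hypothesis the states reachable within a finite horizon are bounded, and small for
small initial states; with the output hypothesis the same holds for outputs. Stability therefore
follows from attractivity, and the system is RGAOS as soon as the output is attractive along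
reachable states (`ReachableAttractivity`).

*From RGAOS to a geometric Lyapunov function.* A weight `μ` that decays fast compared to the growth
of the states can be chosen such that `h(t,x) = ‖H(t,x)‖ + μ(t)‖x‖` is still attractive
(`ReachableAttractivity.exists_weight`). Attractivity provides times `τ m` after which `h ≤ 1/(m+1)`
on all trajectories that start at times and states of size at most `m`. If `a₁ ∈ K_∞` is so flat at
zero that `a₁(1/(m+1)) ≤ 4^(-τ(m+1))/(m+1)`, then `4^(t-t₀) a₁(h(t,x(t)))` is bounded on bounded sets
of initial data and small for small initial states, hence at most `a₂(β(t₀)‖x₀‖)` for some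
`a₂ ∈ K_∞` and `β ∈ K⁺` (`ReachableAttractivity.exists_geometric_decay`,
`exists_classKInf_classKPlus_ge`). The Lyapunov function is the supremum `weightedSup` of
`2^(s-t) a₁(h(s,y))` over all states `y` reachable at times `s` from `x` at time `t`; advancing by one
step costs a factor `1/2`. Because of the gap between the rates `4` and `2` the supremum is
determined, up to a uniformly small error, by a finite horizon, where reachable states depend
uniformly continuously on the initial state; this gives the regularity of `V`
(`ContinuityHypothesis.classCU_weightedSup`).

*From Lyapunov functions to RGAOS.* A geometric Lyapunov function is a perturbed one with `q = 0`. For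
a perturbed one, `V` is bounded along trajectories, and once `q` is small, `V` decreases by a fixed
amount per step until it enters, and then never leaves, a given sublevel set
(`PerturbedLyapunov.reachableAttractivity`).
-/

namespace OutputStability

/-! ### Comparison functions -/

namespace ClassKInf

variable {a : ℝ → ℝ}

theorem monotoneOn (ha : ClassKInf a) : MonotoneOn a (Ici 0) := ha.strictMonoOn.monotoneOn

theorem mono (ha : ClassKInf a) {r s : ℝ} (hr : 0 ≤ r) (hrs : r ≤ s) : a r ≤ a s :=
  ha.monotoneOn hr (hr.trans hrs) hrs

theorem nonneg (ha : ClassKInf a) {s : ℝ} (hs : 0 ≤ s) : 0 ≤ a s :=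
  ha.map_zero ▸ ha.mono le_rfl hs

theorem pos (ha : ClassKInf a) {s : ℝ} (hs : 0 < s) : 0 < a s :=
  ha.map_zero ▸ ha.strictMonoOn (mem_Ici.2 le_rfl) hs.le hs

theorem le_of_map_le (ha : ClassKInf a) {r s : ℝ} (hr : 0 ≤ r) (hs : 0 ≤ s) (h : a r ≤ a s) :
    r ≤ s :=
  (ha.strictMonoOn.le_iff_le hr hs).1 h

/-- A `K_∞` function is small near zero. -/
theorem exists_pos_map_le (ha : ClassKInf a) {ε : ℝ} (hε : 0 < ε) : ∃ δ, 0 < δ ∧ a δ ≤ ε := by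
  have h : Tendsto a (𝓝[≥] 0) (𝓝 0) := by
    simpa [ContinuousWithinAt, ha.map_zero] using ha.continuousOn 0 (mem_Ici.2 le_rfl)
  have h' : ∀ᶠ x in 𝓝[>] (0 : ℝ), a x < ε :=
    (h.mono_left (nhdsWithin_mono _ Ioi_subset_Ici_self)).eventually (gt_mem_nhds hε)
  obtain ⟨δ, h1, h2⟩ := (h'.and self_mem_nhdsWithin).exists
  exact ⟨δ, h2, h1.le⟩

end ClassKInf

/-- Every positive sequence is the restriction to the integers of a `K⁺` function: extend its
logarithm by Tietze's theorem. -/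
theorem exists_classKPlus_eq (m : ℕ → ℝ) (hm : ∀ n, 0 < m n) :
    ∃ b : ℝ → ℝ, ClassKPlus b ∧ ∀ n : ℕ, b n = m n := by
  obtain ⟨g, hg⟩ := ContinuousMap.exists_extension' Nat.isClosedEmbedding_coe_real
    (⟨fun n => Real.log (m n), continuous_of_discreteTopology⟩ : C(ℕ, ℝ))
  refine ⟨fun t => Real.exp (g t), ⟨by fun_prop, fun t _ => Real.exp_pos _⟩, fun n => ?_⟩
  have h : g (n : ℝ) = Real.log (m n) := congrFun hg n
  simp [h, Real.exp_log (hm n)]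

/-- A nondecreasing function that vanishes at `0⁺` is dominated by a `K_∞` function, namely
`r ↦ r + ∫ u in 1..2, G (r * u)`. -/
theorem exists_classKInf_ge {G : ℝ → ℝ} (hmono : Monotone G) (hnonneg : ∀ r, 0 ≤ G r)
    (hsmall : ∀ ε, 0 < ε → ∃ δ, 0 < δ ∧ G δ ≤ ε) :
    ∃ a, ClassKInf a ∧ ∀ r, 0 ≤ r → G r ≤ a r := by
  have hG0 : G 0 = 0 := by
    refine le_antisymm (le_of_forall_pos_le_add fun ε hε => ?_) (hnonneg 0)
    obtain ⟨δ, hδ, h⟩ := hsmall ε hε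
    simpa using (hmono hδ.le).trans h
  have hint : ∀ r, 0 ≤ r → IntervalIntegrable (fun u => G (r * u)) MeasureTheory.volume 1 2 :=
    fun r hr => Monotone.intervalIntegrable fun u v huv =>
      hmono (mul_le_mul_of_nonneg_left huv hr)
  have hlow : ∀ r, 0 ≤ r → G r ≤ ∫ u in (1 : ℝ)..2, G (r * u) := fun r hr => by
    have := intervalIntegral.integral_mono_on (a := 1) (b := 2) (f := fun _ => G r) (by norm_num)
      (by simp) (hint r hr)
      (fun u hu => hmono (le_mul_of_one_le_right hr hu.1))
    norm_num at this
    exact this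
  have hupp : ∀ r, 0 ≤ r → ∫ u in (1 : ℝ)..2, G (r * u) ≤ G (2 * r) := fun r hr => by
    have := intervalIntegral.integral_mono_on (a := 1) (b := 2) (g := fun _ => G (2 * r))
      (by norm_num) (hint r hr) (by simp)
      (fun u hu => hmono (by nlinarith [hu.2]))
    norm_num at this
    exact this
  set F : ℝ → ℝ := fun r => ∫ u in (0 : ℝ)..r, G u with hF
  have hFcont : Continuous F :=
    intervalIntegral.continuous_primitive (fun _ _ => hmono.intervalIntegrable) 0
  have heq : ∀ r, r ≠ 0 → ∫ u in (1 : ℝ)..2, G (r * u) = r⁻¹ * (F (r * 2) - F r) := fun r hr => by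
    rw [intervalIntegral.integral_comp_mul_left G hr, mul_one, smul_eq_mul, hF,
      intervalIntegral.integral_interval_sub_left hmono.intervalIntegrable
        hmono.intervalIntegrable]
  refine ⟨fun r => r + ∫ u in (1 : ℝ)..2, G (r * u), ⟨?_, ?_, ?_, ?_⟩, fun r hr => ?_⟩
  · intro r hr
    rcases eq_or_lt_of_le (mem_Ici.1 hr) with rfl | hr
    · -- at zero the function is squeezed between `0` and `r + G (2 * r)`
      rw [Metric.continuousWithinAt_iff]
      intro ε hε
      obtain ⟨δ, hδ, h⟩ := hsmall (ε / 2) (by positivity)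
      refine ⟨min (ε / 2) (δ / 2), by positivity, fun {r} hr hd => ?_⟩
      have hr0 : 0 ≤ r := hr
      rw [Real.dist_eq, sub_zero, abs_of_nonneg hr0] at hd
      have h1 := lt_of_lt_of_le hd (min_le_left _ _)
      have h2 := lt_of_lt_of_le hd (min_le_right _ _)
      have h3 := hupp r hr0
      have h4 : G (2 * r) ≤ G δ := hmono (by linarith)
      have h5 := (hnonneg r).trans (hlow r hr0)
      simp only [zero_mul, hG0, intervalIntegral.integral_zero, Real.dist_eq, add_zero, sub_zero]
      rw [abs_of_nonneg (by linarith)]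
      linarith
    · have hc : ContinuousAt (fun r => r + r⁻¹ * (F (r * 2) - F r)) r := by
        have : ContinuousAt (fun r : ℝ => r⁻¹) r := continuousAt_inv₀ hr.ne'
        have h2 : Continuous fun r : ℝ => F (r * 2) := by fun_prop
        exact continuousAt_id.add (this.mul (h2.continuousAt.sub hFcont.continuousAt))
      refine (hc.congr ?_).continuousWithinAt
      filter_upwards [isOpen_ne.mem_nhds hr.ne'] with s hs
      rw [heq s hs]
  · intro r hr s hs hrs
    refine add_lt_add_of_lt_of_le hrs ?_
    refine intervalIntegral.integral_mono_on (by norm_num) (hint r hr) (hint s hs) fun u hu =>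
      hmono (mul_le_mul_of_nonneg_right hrs.le (by linarith [hu.1]))
  · simp [hG0]
  · refine tendsto_atTop_mono' _ ?_ tendsto_id
    filter_upwards [eventually_ge_atTop (0 : ℝ)] with r hr
    simpa using (hnonneg r).trans (hlow r hr)
  · exact (hlow r hr).trans (by linarith)

/-- A `K_∞` function that is prescribed to be small along `1 / (m + 1)`: the primitive of the step
function `s ↦ c ⌊1 / s⌋`. -/
theorem exists_classKInf_le {c : ℕ → ℝ} (hc : Antitone c) (hpos : ∀ n, 0 < c n) :
    ∃ a, ClassKInf a ∧ ∀ m : ℕ, a (1 / (m + 1)) ≤ 1 / (m + 1) * c (m + 1) := by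
  set g : ℝ → ℝ := fun s => if s ≤ 0 then 0 else c ⌊1 / s⌋₊ with hg
  have gpos : ∀ s, 0 < s → 0 < g s := fun s hs => by simp [hg, not_le.2 hs, hpos]
  have gmono : Monotone g := by
    intro r s hrs
    by_cases hr : r ≤ 0
    · by_cases hs : s ≤ 0
      · simp [hg, hr, hs]
      · simpa [hg, hr, hs] using (hpos _).le
    · have hr' : 0 < r := not_le.1 hr
      simp only [hg, hr, not_le.2 (hr'.trans_le hrs), if_false]
      exact hc (Nat.floor_mono (one_div_le_one_div_of_le hr' hrs))
  have hint : ∀ a b, IntervalIntegrable g MeasureTheory.volume a b :=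
    fun a b => gmono.intervalIntegrable
  refine ⟨fun s => ∫ u in (0 : ℝ)..s, g u,
    ⟨(intervalIntegral.continuous_primitive hint 0).continuousOn, ?_, by simp, ?_⟩, fun m => ?_⟩
  · intro r hr s hs hrs
    have h := intervalIntegral.integral_add_adjacent_intervals (hint 0 r) (hint r s)
    have h' : 0 < ∫ u in r..s, g u := intervalIntegral.intervalIntegral_pos_of_pos_on (hint r s)
      (fun x hx => gpos x (lt_of_le_of_lt hr hx.1)) hrs
    simp only
    linarith
  · refine tendsto_atTop_mono' (f₁ := fun s => (s + -1) * g 1) _ ?_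
      ((tendsto_atTop_add_const_right atTop (-1 : ℝ) tendsto_id).atTop_mul_const (gpos 1 one_pos))
    filter_upwards [eventually_ge_atTop (1 : ℝ)] with s hs
    have h := intervalIntegral.integral_add_adjacent_intervals (hint 0 1) (hint 1 s)
    have h0 : 0 < ∫ u in (0 : ℝ)..1, g u :=
      intervalIntegral.intervalIntegral_pos_of_pos_on (hint 0 1) (fun x hx => gpos x hx.1) one_pos
    have h1 := intervalIntegral.integral_mono_on (f := fun _ => g 1) hs (by simp) (hint 1 s)
      (fun u hu => gmono hu.1)
    rw [intervalIntegral.integral_const, smul_eq_mul] at h1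
    linarith
  · have hm : (0 : ℝ) < 1 / (m + 1) := by positivity
    have hval : g (1 / (m + 1)) = c (m + 1) := by
      have : ⌊(m : ℝ) + 1⌋₊ = m + 1 := by exact_mod_cast Nat.floor_natCast (R := ℝ) (m + 1)
      simp only [hg, not_le.2 hm, if_false, one_div_one_div, this]
    have h1 := intervalIntegral.integral_mono_on (g := fun _ => g (1 / (m + 1))) hm.le
      (hint 0 _) (by simp) (fun u hu => gmono hu.2)
    rw [intervalIntegral.integral_const, smul_eq_mul, sub_zero, hval] at h1
    exact h1

/-- A family `w` of reals indexed by objects with a time `T` and a size `s`, bounded for bounded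
times and sizes, and small for bounded times and small sizes, is dominated by `a (β (T) * s)` with
`a ∈ K_∞` and `β ∈ K⁺`. -/
theorem exists_classKInf_classKPlus_ge {ι : Type*} (w : ι → ℝ) (T : ι → ℕ) (s : ι → ℝ)
    (hs : ∀ i, 0 ≤ s i)
    (hbdd : ∀ (N : ℕ) (R : ℝ), ∃ C, ∀ i, T i ≤ N → s i ≤ R → w i ≤ C)
    (hsmall : ∀ (N : ℕ) (ε : ℝ), 0 < ε → ∃ δ, 0 < δ ∧ ∀ i, T i ≤ N → s i ≤ δ → w i ≤ ε) :
    ∃ a β, ClassKInf a ∧ ClassKPlus β ∧ ∀ i, w i ≤ a (β (T i) * s i) := by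
  have h : ∀ n : ℕ, ∃ δ, 0 < δ ∧ δ ≤ 1 ∧ ∀ i, T i ≤ n → s i ≤ δ → w i ≤ 1 / ((n : ℝ) + 1) :=
    fun n => by
      obtain ⟨δ, h0, h⟩ := hsmall n (1 / ((n : ℝ) + 1)) (by positivity)
      exact ⟨min δ 1, by positivity, min_le_right _ _,
        fun i hi hi' => h i hi (hi'.trans (min_le_left _ _))⟩
  choose δ hδ hδ1 hw using h
  -- the weight `(n + 1) / δ n` makes the members with a large time irrelevant, uniformly for
  -- weighted sizes in a bounded set
  obtain ⟨β, hβ, hβn⟩ := exists_classKPlus_eq (fun n => (n + 1) / δ n)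
    (fun n => div_pos (by positivity) (hδ n))
  have hle : ∀ i, s i ≤ β (T i) * s i := fun i => by
    refine le_mul_of_one_le_left (hs i) ?_
    rw [hβn, one_le_div (hδ _)]
    linarith [hδ1 (T i), (T i).cast_nonneg (α := ℝ)]
  have hlate : ∀ i r, β (T i) * s i ≤ r → r ≤ T i + 1 → w i ≤ 1 / ((T i : ℝ) + 1) :=
    fun i r h1 h2 => by
      refine hw _ i le_rfl ?_
      rw [hβn, div_mul_eq_mul_div, div_le_iff₀ (hδ _)] at h1
      have h3 : ((T i : ℝ) + 1) * s i ≤ (T i + 1) * δ (T i) :=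
        h1.trans (mul_le_mul_of_nonneg_right h2 (hδ _).le)
      exact le_of_mul_le_mul_left h3 (by positivity)
  set S : ℝ → Set ℝ := fun r => insert 0 {v | ∃ i, β (T i) * s i ≤ r ∧ v = w i} with hS
  have hSbdd : ∀ r, BddAbove (S r) := fun r => by
    obtain ⟨C, hC⟩ := hbdd ⌈r⌉₊ r
    refine ⟨max C 1, ?_⟩
    rintro v (rfl | ⟨i, hi, rfl⟩)
    · exact le_max_of_le_right zero_le_one
    · by_cases hT : T i ≤ ⌈r⌉₊
      · exact le_max_of_le_left (hC i hT ((hle i).trans hi))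
      · refine le_max_of_le_right ((hlate i r hi ?_).trans ?_)
        · have h1 : (⌈r⌉₊ : ℝ) ≤ T i := by exact_mod_cast (not_le.1 hT).le
          linarith [Nat.le_ceil r]
        · rw [div_le_one (by positivity)]
          linarith [(T i).cast_nonneg (α := ℝ)]
  obtain ⟨a, ha, hGa⟩ := exists_classKInf_ge (G := fun r => sSup (S r))
    (fun r r' hrr => csSup_le_csSup (hSbdd r') ⟨0, mem_insert _ _⟩
      (insert_subset_insert fun v ⟨i, hi, hv⟩ => ⟨i, hi.trans hrr, hv⟩))
    (fun r => le_csSup (hSbdd r) (mem_insert _ _)) (by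
      intro ε hε
      obtain ⟨m, hm⟩ := exists_nat_one_div_lt hε
      obtain ⟨d, hd, hd'⟩ := hsmall m ε hε
      refine ⟨min d 1, by positivity, csSup_le ⟨0, mem_insert _ _⟩ ?_⟩
      rintro v (rfl | ⟨i, hi, rfl⟩)
      · exact hε.le
      · by_cases hT : T i ≤ m
        · exact hd' i hT (((hle i).trans hi).trans (min_le_left _ _))
        · refine (hlate i 1 (hi.trans (min_le_right _ _))
            (by linarith [(T i).cast_nonneg (α := ℝ)])).trans (le_trans ?_ hm.le)
          have h1 : (m : ℝ) ≤ T i := by exact_mod_cast (not_le.1 hT).le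
          exact one_div_le_one_div_of_le (by positivity) (by linarith))
  refine ⟨a, β, ha, hβ, fun i => le_trans ?_ (hGa _ ((hs i).trans (hle i)))⟩
  exact le_csSup (hSbdd _) (mem_insert_of_mem _ ⟨i, le_rfl, rfl⟩)

/-! ### Reachable states -/

/-- `Reachable f t₀ x₀ t x`: some disturbance steers the state `x₀` at time `t₀` to the state `x` at
time `t`. Only the disturbance values actually used appear, so that for an empty disturbance set the
initial state is still reachable at the initial time. -/
inductive Reachable {X D : Type*} (f : ℕ → D → X → X) (t₀ : ℕ) (x₀ : X) : ℕ → X → Prop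
  | initial : Reachable f t₀ x₀ t₀ x₀
  | step {t : ℕ} {x : X} (d : D) : Reachable f t₀ x₀ t x → Reachable f t₀ x₀ (t + 1) (f t d x)

namespace Reachable

variable {X D : Type*} {f : ℕ → D → X → X} {t₀ t : ℕ} {x₀ x : X}

theorem le (h : Reachable f t₀ x₀ t x) : t₀ ≤ t := by
  induction h with
  | initial => exact le_rfl
  | step _ _ ih => omega

theorem of_solution (d : ℕ → D) (h : t₀ ≤ t) : Reachable f t₀ x₀ t (solution f d t₀ x₀ t) := by
  induction t, h using Nat.le_induction with
  | base => rw [solution_initial]; exact initial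
  | succ t h ih => rw [solution_succ f d t₀ x₀ t h]; exact ih.step (d t)

/-- The first step of a trajectory may be split off. -/
theorem head (d : D) (h : Reachable f (t₀ + 1) (f t₀ d x₀) t x) : Reachable f t₀ x₀ t x := by
  induction h with
  | initial => exact initial.step d
  | step d' _ ih => exact ih.step d'

theorem exists_solution [Nonempty D] (h : Reachable f t₀ x₀ t x) :
    ∃ d : ℕ → D, x = solution f d t₀ x₀ t := by
  induction h with
  | initial => exact ⟨fun _ => Classical.arbitrary D, (solution_initial ..).symm⟩
  | @step t y d h ih =>
    obtain ⟨e, rfl⟩ := ih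
    -- changing the disturbance at time `t` leaves the solution up to time `t` unchanged
    have key : ∀ s ≤ t, solution f (Function.update e t d) t₀ x₀ s = solution f e t₀ x₀ s := by
      intro s
      induction s with
      | zero => intro _; rfl
      | succ s ih =>
        intro hs
        simp only [solution, ih (by omega), Function.update_of_ne (by omega : s ≠ t)]
    refine ⟨Function.update e t d, ?_⟩
    rw [solution_succ _ _ _ _ _ h.le, key t le_rfl, Function.update_self]

end Reachable

/-! ### Bounds on finite time horizons -/

section Horizon

variable {X Y D : Type*} [NormedAddCommGroup X] [NormedAddCommGroup Y]

/-- Under the growth hypothesis the norm of a state reachable at time `t` is bounded by a continuous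
nondecreasing function of the norm of the initial state that vanishes at zero. -/
theorem GrowthHypothesis.exists_norm_le {f : ℕ → D → X → X} (hf : GrowthHypothesis f) :
    ∃ A : ℕ → ℝ → ℝ, (∀ n, ContinuousOn (A n) (Ici 0)) ∧ (∀ n, MonotoneOn (A n) (Ici 0)) ∧
      (∀ n, A n 0 = 0) ∧ (∀ s, Monotone fun n => A n s) ∧ (∀ n s, s ≤ A n s) ∧
      ∀ t₀ x₀ t x, Reachable f t₀ x₀ t x → ‖x‖ ≤ A t ‖x₀‖ := by
  obtain ⟨a, β, ha, hβ, hf⟩ := hf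
  let A : ℕ → ℝ → ℝ := fun n => Nat.rec (fun s => s) (fun k B s => max (B s) (a (β k * B s))) n
  have hsucc : ∀ n s, A (n + 1) s = max (A n s) (a (β n * A n s)) := fun _ _ => rfl
  have hmono : ∀ s, Monotone fun n => A n s := fun s =>
    monotone_nat_of_le_succ fun n => by rw [hsucc]; exact le_max_left _ _
  have hge : ∀ n s, s ≤ A n s := fun n s => hmono s (Nat.zero_le n)
  have hβ0 : ∀ n : ℕ, 0 ≤ β n := fun n => (hβ.pos n n.cast_nonneg).le
  have hnonneg : ∀ n : ℕ, ∀ s ∈ Ici (0 : ℝ), β n * A n s ∈ Ici (0 : ℝ) := fun n s hs =>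
    mul_nonneg (hβ0 n) (le_trans hs (hge n s))
  have hmonoOn : ∀ n, MonotoneOn (A n) (Ici 0) := by
    intro n
    induction n with
    | zero => exact monotone_id.monotoneOn _
    | succ n ih =>
      intro r hr s hs hrs
      rw [hsucc, hsucc]
      exact max_le_max (ih hr hs hrs)
        (ha.mono (hnonneg n r hr) (mul_le_mul_of_nonneg_left (ih hr hs hrs) (hβ0 n)))
  refine ⟨A, ?_, hmonoOn, ?_, hmono, hge, ?_⟩
  · intro n
    induction n with
    | zero => exact continuousOn_id
    | succ n ih => exact ih.sup (ha.continuousOn.comp (continuousOn_const.mul ih) (hnonneg n))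
  · intro n
    induction n with
    | zero => rfl
    | succ n ih => rw [hsucc, ih]; simp [ha.map_zero]
  · intro t₀ x₀ t x h
    induction h with
    | initial => exact hge _ _
    | @step t y d h ih =>
      rw [hsucc]
      exact le_max_of_le_right ((hf t d y).trans (ha.mono
        (mul_nonneg (hβ0 t) (norm_nonneg _)) (mul_le_mul_of_nonneg_left ih (hβ0 t))))

theorem OutputHypothesis.exists_norm_le {H : ℕ → X → Y} (hH : OutputHypothesis H) (N : ℕ) (R : ℝ) :
    ∃ C, ∀ t ≤ N, ∀ x, ‖x‖ ≤ R → ‖H t x‖ ≤ C := by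
  obtain ⟨h, -⟩ := hH.1 (Iic N) (Metric.closedBall 0 R) (finite_Iic N).isBounded
    Metric.isBounded_closedBall 1 one_pos
  obtain ⟨C, hC⟩ := h.exists_norm_le
  exact ⟨C, fun t ht x hx => hC _ ⟨t, ht, x, by simpa using hx, rfl⟩⟩

theorem OutputHypothesis.exists_norm_lt {H : ℕ → X → Y} (hH : OutputHypothesis H) (N : ℕ) {ε : ℝ}
    (hε : 0 < ε) : ∃ δ, 0 < δ ∧ ∀ t ≤ N, ∀ x, ‖x‖ < δ → ‖H t x‖ < ε := by
  obtain ⟨-, δ, hδ, h⟩ := hH.1 (Iic N) (Metric.closedBall 0 1) (finite_Iic N).isBounded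
    Metric.isBounded_closedBall ε hε
  refine ⟨min δ 1, by positivity, fun t ht x hx => ?_⟩
  have h1 := h t ht x (by simpa using (hx.trans_le (min_le_right _ _)).le) 0 (by simp)
    (by simpa using hx.trans_le (min_le_left _ _))
  simpa [hH.2] using h1

/-- Outputs are bounded on a finite time horizon. -/
theorem exists_output_le {f : ℕ → D → X → X} {H : ℕ → X → Y} (hf : GrowthHypothesis f)
    (hH : OutputHypothesis H) (N : ℕ) (R : ℝ) :
    ∃ C, ∀ t₀ x₀ t x, Reachable f t₀ x₀ t x → t ≤ N → ‖x₀‖ ≤ R → ‖H t x‖ ≤ C := by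
  obtain ⟨A, -, hA, -, hAN, -, h⟩ := hf.exists_norm_le
  obtain ⟨C, hC⟩ := hH.exists_norm_le N (A N R)
  exact ⟨C, fun t₀ x₀ t x hr ht hx => hC t ht x ((h _ _ _ _ hr).trans ((hAN _ ht).trans
    (hA N (norm_nonneg _) ((norm_nonneg _).trans hx) hx)))⟩

/-- Outputs are small on a finite time horizon if the initial state is small. -/
theorem exists_output_lt {f : ℕ → D → X → X} {H : ℕ → X → Y} (hf : GrowthHypothesis f)
    (hH : OutputHypothesis H) (N : ℕ) {ε : ℝ} (hε : 0 < ε) :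
    ∃ δ, 0 < δ ∧
      ∀ t₀ x₀ t x, Reachable f t₀ x₀ t x → t ≤ N → ‖x₀‖ ≤ δ → ‖H t x‖ < ε := by
  obtain ⟨A, hAc, hA, hA0, hAN, -, h⟩ := hf.exists_norm_le
  obtain ⟨η, hη, hη'⟩ := hH.exists_norm_lt N hε
  have h0 : Tendsto (A N) (𝓝[≥] 0) (𝓝 0) := by
    simpa [ContinuousWithinAt, hA0] using hAc N 0 (mem_Ici.2 le_rfl)
  have h1 : ∀ᶠ s in 𝓝[>] (0 : ℝ), A N s < η :=
    (h0.mono_left (nhdsWithin_mono _ Ioi_subset_Ici_self)).eventually (gt_mem_nhds hη)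
  obtain ⟨δ, hδA, hδ⟩ := (h1.and self_mem_nhdsWithin).exists
  have hδ : 0 < δ := hδ
  exact ⟨δ, hδ, fun t₀ x₀ t x hr ht hx => hη' t ht x (lt_of_le_of_lt ((h _ _ _ _ hr).trans
    ((hAN _ ht).trans (hA N (norm_nonneg _) hδ.le hx))) hδA)⟩

end Horizon

/-! ### Attractivity of the output along reachable states -/

section Attractivity

variable {X Y D : Type*} [NormedAddCommGroup X] [NormedAddCommGroup Y]
  {f : ℕ → D → X → X} {H : ℕ → X → Y}

/-- Robust output attractivity, expressed with reachable states instead of solutions. -/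
def ReachableAttractivity (f : ℕ → D → X → X) (H : ℕ → X → Y) : Prop :=
  ∀ (ε : ℝ) (T : ℕ) (R : ℝ), 0 < ε → ∃ τ : ℕ, ∀ t₀ x₀ t x, Reachable f t₀ x₀ t x → t₀ ≤ T →
    ‖x₀‖ ≤ R → t₀ + τ ≤ t → ‖H t x‖ ≤ ε

theorem RobustOutputAttractivity.reachable (h : RobustOutputAttractivity f H) :
    ReachableAttractivity f H := by
  intro ε T R hε
  rcases isEmpty_or_nonempty D with hD | hD
  · refine ⟨1, fun t₀ x₀ t x hr _ _ ht => ?_⟩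
    cases hr with
    | initial => omega
    | step d _ => exact hD.elim d
  · obtain ⟨τ, hτ⟩ := h ε T (max R 0) hε (le_max_right _ _)
    refine ⟨τ, fun t₀ x₀ t x hr hT hx ht => ?_⟩
    obtain ⟨d, rfl⟩ := hr.exists_solution
    exact hτ x₀ t₀ (hx.trans (le_max_left _ _)) hT t ht d

/-- Under the growth and output hypotheses attractivity implies stability: the output is controlled
on a finite horizon by the growth of the state, and afterwards by attractivity. -/
theorem ReachableAttractivity.rgaos (hf : GrowthHypothesis f) (hH : OutputHypothesis H)
    (h : ReachableAttractivity f H) : RGAOS f H := by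
  refine ⟨fun ε T hε => ⟨?_, ?_⟩, fun ε T R hε _ => ?_⟩
  · obtain ⟨τ, hτ⟩ := h ε T ε hε
    obtain ⟨C, hC⟩ := exists_output_le hf hH (T + τ) ε
    refine ⟨max C ε, ?_⟩
    rintro r ⟨t, t₀, x₀, d, ht, hx, hT, rfl⟩
    rcases le_total (t₀ + τ) t with h' | h'
    · exact le_max_of_le_right (hτ _ _ _ _ (.of_solution d ht) hT hx h')
    · exact le_max_of_le_left (hC _ _ _ _ (.of_solution d ht) (by omega) hx)
  · obtain ⟨τ, hτ⟩ := h ε T 1 hε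
    obtain ⟨δ, hδ, hC⟩ := exists_output_lt hf hH (T + τ) hε
    refine ⟨min δ 1, by positivity, fun x₀ t₀ hx hT t ht d => ?_⟩
    rcases le_total (t₀ + τ) t with h' | h'
    · exact hτ _ _ _ _ (.of_solution d ht) hT (hx.trans (min_le_right _ _)) h'
    · exact (hC _ _ _ _ (.of_solution d ht) (by omega) (hx.trans (min_le_left _ _))).le
  · obtain ⟨τ, hτ⟩ := h ε T R hε
    exact ⟨τ, fun x₀ t₀ hx hT t ht d =>
      hτ _ _ _ _ (.of_solution d (by omega)) hT hx ht⟩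

end Attractivity

/-! ### Sufficiency of the Lyapunov conditions -/

section Sufficiency

variable {X Y D : Type*} [NormedAddCommGroup X] [NormedAddCommGroup Y]
  {f : ℕ → D → X → X} {H : ℕ → X → Y} {V : ℕ → X → ℝ}

theorem GeometricLyapunov.perturbed (h : GeometricLyapunov f H V) : PerturbedLyapunov f H V := by
  obtain ⟨hV, a₁, a₂, β, μ, c, ha₁, ha₂, hβ, hμ, hc0, hc1, hb, hd⟩ := h
  refine ⟨hV, a₁, a₂, fun s => (1 - c) * s, β, fun _ => 0, ha₁, ha₂, ⟨by fun_prop, ?_, by simp, ?_⟩,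
    fun s hs => by nlinarith, hβ, continuousOn_const, fun _ _ => le_rfl, tendsto_const_nhds,
    fun t x => ⟨(ha₁.mono (norm_nonneg _) ?_).trans (hb t x).1, (hb t x).2⟩, fun t x d => ?_⟩
  · exact fun r _ s _ hrs => mul_lt_mul_of_pos_left hrs (by linarith)
  · exact tendsto_id.const_mul_atTop (by linarith)
  · exact le_add_of_nonneg_right (mul_nonneg (hμ.pos t t.cast_nonneg).le (norm_nonneg _))
  · linarith [hd t x d]

/-- Along trajectories `V` stays bounded because `q` is bounded, and once `q` is small compared to a
level `η` of `V`, the value of `V` decreases by a fixed amount per step until it is at most `η`. -/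
theorem PerturbedLyapunov.reachableAttractivity (h : PerturbedLyapunov f H V) :
    ReachableAttractivity f H := by
  obtain ⟨hV, a₁, a₂, a₃, β, q, ha₁, ha₂, ha₃, hle, hβ, -, hq0, hq, hb, hd⟩ := h
  intro ε T R hε
  have hqn : Tendsto (fun n : ℕ => q n) atTop (𝓝 0) := hq.comp tendsto_natCast_atTop_atTop
  obtain ⟨Q, hQ⟩ := hqn.bddAbove_range
  have hQ : ∀ n : ℕ, q n ≤ Q := fun n => hQ ⟨n, rfl⟩
  obtain ⟨B, hB⟩ := ((finite_Iic T).image fun n : ℕ => β n).bddAbove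
  have hB : ∀ n ≤ T, β n ≤ B := fun n hn => hB ⟨n, hn, rfl⟩
  -- a level above which `V` cannot increase
  obtain ⟨L, hL0, hL⟩ : ∃ L, 0 ≤ L ∧ Q ≤ a₃ L :=
    ((eventually_ge_atTop 0).and (ha₃.tendsto_atTop.eventually_ge_atTop Q)).exists
  have hM : ∃ M, ∀ t₀ x₀ t x, Reachable f t₀ x₀ t x → t₀ ≤ T → ‖x₀‖ ≤ R → V t x ≤ M := by
    refine ⟨max (a₂ (B * R)) (L + Q), fun t₀ x₀ t x hr hT hx => ?_⟩
    induction hr with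
    | initial =>
      refine le_max_of_le_left ((hb _ _).2.trans ?_)
      have hβ0 := (hβ.pos t₀ t₀.cast_nonneg).le
      exact ha₂.mono (mul_nonneg hβ0 (norm_nonneg _))
        (mul_le_mul (hB _ hT) hx (norm_nonneg _) (hβ0.trans (hB _ hT)))
    | @step t y d hr ih =>
      have h1 := hd t y d
      have h2 := hQ t
      rcases le_total L (V t y) with h3 | h3
      · have h4 := ha₃.mono hL0 h3
        exact (by linarith : V (t + 1) (f t d y) ≤ V t y).trans ih
      · have h4 := ha₃.nonneg (hV t y)
        exact le_max_of_le_right (by linarith)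
  obtain ⟨M, hM⟩ := hM
  set η := a₁ ε with hη
  have hη0 : 0 < η := ha₁.pos hε
  set κ := a₃ (η / 2) / 2 with hκ
  have hκ0 : 0 < κ := half_pos (ha₃.pos (half_pos hη0))
  obtain ⟨T₁, hT₁⟩ := eventually_atTop.1
    (hqn.eventually (ge_mem_nhds (lt_min (half_pos hη0) hκ0)))
  set S := max T T₁ with hS
  have key : ∀ t₀ x₀ t x, Reachable f t₀ x₀ t x → t₀ ≤ T → ‖x₀‖ ≤ R → S ≤ t →
      V t x ≤ max η (M - ((t : ℝ) - S) * κ) := by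
    intro t₀ x₀ t x hr hT hx ht
    induction hr with
    | initial =>
      have : t₀ = S := le_antisymm (hT.trans (le_max_left _ _)) ht
      have h1 := hM _ _ _ _ Reachable.initial hT hx
      rw [this] at h1 ⊢
      exact le_max_of_le_right (by simpa using h1)
    | @step t y d hr ih =>
      rcases Nat.lt_or_ge t S with h1 | h1
      · have h2 : t + 1 = S := by omega
        have h3 := hM _ _ _ _ (hr.step d) hT hx
        refine le_max_of_le_right ?_
        rw [← h2]
        simpa using h3
      · have h2 := hT₁ t ((le_max_right _ _).trans h1)
        have h3 := h2.trans (min_le_left _ _)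
        have h4 := h2.trans (min_le_right _ _)
        have h5 := hd t y d
        have h6 := ha₃.nonneg (hV t y)
        rcases le_total (V t y) (η / 2) with h7 | h7
        · exact le_max_of_le_left (by linarith)
        · have h8 := ha₃.mono (half_pos hη0).le h7
          rcases le_max_iff.1 (ih h1) with h9 | h9
          · exact le_max_of_le_left (by linarith)
          · refine le_max_of_le_right ?_
            push_cast
            linarith
  obtain ⟨n, hn⟩ := exists_nat_ge (M / κ)
  rw [div_le_iff₀ hκ0] at hn
  refine ⟨S + n, fun t₀ x₀ t x hr hT hx ht => ?_⟩
  refine ha₁.le_of_map_le (norm_nonneg _) hε.le ((hb t x).1.trans ?_)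
  refine (key _ _ _ _ hr hT hx (by omega)).trans (max_le le_rfl ?_)
  have h1 : (S : ℝ) + n ≤ t := by exact_mod_cast (by omega : S + n ≤ t)
  nlinarith

end Sufficiency

/-! ### Decay of the weighted output -/

section Decay

variable {X Y D : Type*} [NormedAddCommGroup X] [NormedAddCommGroup Y]
  {f : ℕ → D → X → X} {H : ℕ → X → Y}

theorem OutputHypothesis.norm_add_weight (hH : OutputHypothesis H) {μ : ℝ → ℝ}
    (hμ : ClassKPlus μ) : OutputHypothesis fun t x => ‖H t x‖ + μ t * ‖x‖ := by
  refine ⟨fun I S hI hS ε hε => ?_, fun t => by simp [hH.2]⟩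
  obtain ⟨hb, δ, hδ, h⟩ := hH.1 I S hI hS (ε / 2) (by positivity)
  obtain ⟨C, hC⟩ := hb.exists_norm_le
  obtain ⟨R, hR⟩ := hS.exists_norm_le
  obtain ⟨N, hN⟩ := hI.bddAbove
  obtain ⟨B, hB⟩ := ((finite_Iic N).image fun n : ℕ => μ n).bddAbove
  have hB : ∀ n ∈ I, μ n ≤ B := fun n hn => hB ⟨n, hN hn, rfl⟩
  have hμ0 : ∀ n : ℕ, 0 < μ n := fun n => hμ.pos n n.cast_nonneg
  refine ⟨isBounded_iff_forall_norm_le.2 ⟨C + B * R, ?_⟩, min δ (ε / (2 * (|B| + 1))),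
    by positivity, fun t ht x hx x₀ hx₀ hd => ?_⟩
  · rintro _ ⟨t, ht, x, hx, rfl⟩
    rw [Real.norm_of_nonneg (add_nonneg (norm_nonneg _)
      (mul_nonneg (hμ0 t).le (norm_nonneg _)))]
    exact add_le_add (hC _ ⟨t, ht, x, hx, rfl⟩) (mul_le_mul (hB t ht) (hR x hx) (norm_nonneg _)
      ((hμ0 t).le.trans (hB t ht)))
  · have h1 := h t ht x hx x₀ hx₀ (hd.trans_le (min_le_left _ _))
    have h2 := hd.trans_le (min_le_right _ _)
    rw [lt_div_iff₀ (by positivity)] at h2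
    have h3 := (abs_norm_sub_norm_le (H t x) (H t x₀)).trans_lt h1
    have h4 : |μ t * ‖x‖ - μ t * ‖x₀‖| ≤ (|B| + 1) * ‖x - x₀‖ := by
      rw [← mul_sub, abs_mul, abs_of_pos (hμ0 t)]
      have h5 : μ t ≤ |B| + 1 := by linarith [hB t ht, le_abs_self B]
      exact mul_le_mul h5 (abs_norm_sub_norm_le _ _) (abs_nonneg _) (by positivity)
    rw [Real.norm_eq_abs, add_sub_add_comm]
    refine (abs_add_le _ _).trans_lt ?_
    linarith

/-- Adding to the output a multiple of the state, with a weight that decays fast enough compared to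
the growth of the states, preserves attractivity. -/
theorem ReachableAttractivity.exists_weight (hf : GrowthHypothesis f)
    (h : ReachableAttractivity f H) : ∃ μ, ClassKPlus μ ∧
      ReachableAttractivity f fun t x => ‖H t x‖ + μ t * ‖x‖ := by
  obtain ⟨A, -, hA, -, -, hge, hfA⟩ := hf.exists_norm_le
  have hA0 : ∀ n : ℕ, 0 ≤ A n n := fun n => n.cast_nonneg.trans (hge n n)
  have hm : ∀ n : ℕ, (0 : ℝ) < 1 / ((n + 1) * (A n n + 1)) := fun n => by
    have := hA0 n
    positivity
  obtain ⟨μ, hμ, hμn⟩ := exists_classKPlus_eq _ hm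
  refine ⟨μ, hμ, fun ε T R hε => ?_⟩
  obtain ⟨τ, hτ⟩ := h (ε / 2) T R (by positivity)
  obtain ⟨k, hk⟩ := exists_nat_one_div_lt (half_pos hε)
  refine ⟨max τ (max k ⌈R⌉₊), fun t₀ x₀ t x hr hT hx ht => ?_⟩
  have h1 := hτ _ _ _ _ hr hT hx (by omega)
  have hR : R ≤ t := (Nat.le_ceil R).trans (by exact_mod_cast (by omega : ⌈R⌉₊ ≤ t))
  have hx' : ‖x‖ ≤ A t t + 1 := by
    linarith [hfA _ _ _ _ hr, hA t (norm_nonneg x₀) (mem_Ici.2 t.cast_nonneg) (hx.trans hR)]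
  have h2 : μ t * ‖x‖ ≤ ε / 2 := by
    have hAt : 0 < A t t + 1 := by linarith [hA0 t]
    calc μ t * ‖x‖ ≤ μ t * (A t t + 1) :=
          mul_le_mul_of_nonneg_left hx' (hμ.pos t t.cast_nonneg).le
      _ = 1 / ((t : ℝ) + 1) := by rw [hμn]; field_simp
      _ ≤ 1 / ((k : ℝ) + 1) := by
          have : (k : ℝ) ≤ t := by exact_mod_cast (by omega : k ≤ t)
          exact one_div_le_one_div_of_le (by positivity) (by linarith)
      _ ≤ ε / 2 := hk.le
  rw [Real.norm_of_nonneg (add_nonneg (norm_nonneg _)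
    (mul_nonneg (hμ.pos t t.cast_nonneg).le (norm_nonneg _)))]
  linarith

/-- An attractive output decays at a geometric rate after composition with a `K_∞` function that is
flat enough at zero. -/
theorem ReachableAttractivity.exists_geometric_decay (hf : GrowthHypothesis f)
    (hH : OutputHypothesis H) (h : ReachableAttractivity f H) :
    ∃ a₁ a₂ β, ClassKInf a₁ ∧ ClassKInf a₂ ∧ ClassKPlus β ∧ ∀ t₀ x₀ t x,
      Reachable f t₀ x₀ t x → 4 ^ (t - t₀) * a₁ ‖H t x‖ ≤ a₂ (β t₀ * ‖x₀‖) := by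
  -- after time `τ m` the outputs starting from times and states of size at most `m` are at most
  -- `1 / (m + 1)`
  obtain ⟨τ, hτ, hH'⟩ := extraction_forall_of_eventually
    (P := fun m k => ∀ t₀ x₀ t x, Reachable f t₀ x₀ t x → t₀ ≤ m → ‖x₀‖ ≤ m → t₀ + k ≤ t →
      ‖H t x‖ ≤ 1 / ((m : ℝ) + 1)) fun m => by
    obtain ⟨k, hk⟩ := h (1 / ((m : ℝ) + 1)) m m (by positivity)
    filter_upwards [eventually_ge_atTop k] with l hl t₀ x₀ t x hr h1 h2 h3
    exact hk _ _ _ _ hr h1 h2 (by omega)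
  obtain ⟨a, ha, ham⟩ := exists_classKInf_le (c := fun n => 1 / (4 : ℝ) ^ τ n)
    (fun m n hmn => one_div_le_one_div_of_le (by positivity)
      (pow_le_pow_right₀ (by norm_num) (hτ.monotone hmn))) (fun n => by positivity)
  have late : ∀ n t₀ x₀ t x, Reachable f t₀ x₀ t x → t₀ ≤ n → ‖x₀‖ ≤ n → t₀ + τ n ≤ t →
      4 ^ (t - t₀) * a ‖H t x‖ ≤ 1 / ((n : ℝ) + 1) := by
    intro n t₀ x₀ t x hr hn hx ht
    -- the block `τ m ≤ t - t₀ < τ (m + 1)` containing the elapsed time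
    set m := Nat.findGreatest (fun i => τ i ≤ t - t₀) (t - t₀) with hm
    have hnk : τ n ≤ t - t₀ := by omega
    have hm1 : τ m ≤ t - t₀ :=
      Nat.findGreatest_spec (P := fun i => τ i ≤ t - t₀) ((hτ.le_apply).trans hnk) hnk
    have hnm : n ≤ m := Nat.le_findGreatest ((hτ.le_apply).trans hnk) hnk
    have hm2 : t - t₀ < τ (m + 1) := by
      by_contra! hc
      have : m + 1 ≤ m := Nat.le_findGreatest ((hτ.le_apply).trans hc) hc
      omega
    have hnm' : (n : ℝ) ≤ m := by exact_mod_cast hnm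
    have h1 : ‖H t x‖ ≤ 1 / ((m : ℝ) + 1) :=
      hH' m _ _ _ _ hr (hn.trans hnm) (hx.trans hnm') (by omega)
    have h2 := (ha.mono (norm_nonneg _) h1).trans (ham m)
    have h3 : (4 : ℝ) ^ (t - t₀) ≤ 4 ^ τ (m + 1) := pow_le_pow_right₀ (by norm_num) hm2.le
    calc (4 : ℝ) ^ (t - t₀) * a ‖H t x‖
        ≤ 4 ^ τ (m + 1) * (1 / ((m : ℝ) + 1) * (1 / 4 ^ τ (m + 1))) :=
          mul_le_mul h3 h2 (ha.nonneg (norm_nonneg _)) (by positivity)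
      _ = 1 / ((m : ℝ) + 1) := by field_simp
      _ ≤ 1 / ((n : ℝ) + 1) := one_div_le_one_div_of_le (by positivity) (by linarith)
  have early : ∀ n t₀ x₀ t x η, Reachable f t₀ x₀ t x → t ≤ t₀ + τ n → ‖H t x‖ ≤ η →
      4 ^ (t - t₀) * a ‖H t x‖ ≤ 4 ^ τ n * a η := fun n t₀ x₀ t x η hr ht hη =>
    mul_le_mul (pow_le_pow_right₀ (by norm_num) (by omega)) (ha.mono (norm_nonneg _) hη)
      (ha.nonneg (norm_nonneg _)) (by positivity)
  let ι := {p : (ℕ × X) × (ℕ × X) // Reachable f p.1.1 p.1.2 p.2.1 p.2.2}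
  obtain ⟨a₂, β, ha₂, hβ, hw⟩ : ∃ a₂ β, ClassKInf a₂ ∧ ClassKPlus β ∧ ∀ i : ι,
      4 ^ (i.1.2.1 - i.1.1.1) * a ‖H i.1.2.1 i.1.2.2‖ ≤ a₂ (β i.1.1.1 * ‖i.1.1.2‖) := by
    refine exists_classKInf_classKPlus_ge (ι := ι)
      (fun i => 4 ^ (i.1.2.1 - i.1.1.1) * a ‖H i.1.2.1 i.1.2.2‖) (fun i => i.1.1.1)
      (fun i => ‖i.1.1.2‖) (fun i => norm_nonneg _) ?_ ?_
    · intro N R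
      set n := max N ⌈R⌉₊ with hn
      obtain ⟨C, hC⟩ := exists_output_le hf hH (N + τ n) R
      refine ⟨max 1 (4 ^ τ n * a C), ?_⟩
      rintro ⟨⟨⟨t₀, x₀⟩, t, x⟩, hr⟩ hT hx
      simp only at hr hT hx ⊢
      rcases le_total (t₀ + τ n) t with h' | h'
      · refine le_max_of_le_left ((late n _ _ _ _ hr (by omega) ?_ h').trans ?_)
        · exact hx.trans ((Nat.le_ceil R).trans (by exact_mod_cast le_max_right _ _))
        · rw [div_le_one (by positivity)]
          linarith [n.cast_nonneg (α := ℝ)]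
      · exact le_max_of_le_right (early n _ _ _ _ _ hr h' (hC _ _ _ _ hr (by omega) hx))
    · intro N ε hε
      obtain ⟨k, hk⟩ := exists_nat_one_div_lt hε
      set n := max N (k + 1) with hn
      obtain ⟨η, hη, hη'⟩ := ha.exists_pos_map_le (ε := ε / 4 ^ τ n) (by positivity)
      obtain ⟨δ, hδ, hC⟩ := exists_output_lt hf hH (N + τ n) hη
      refine ⟨min δ 1, by positivity, ?_⟩
      rintro ⟨⟨⟨t₀, x₀⟩, t, x⟩, hr⟩ hT hx
      simp only at hr hT hx ⊢
      have hkn : (k : ℝ) + 1 ≤ n := by exact_mod_cast le_max_right N (k + 1)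
      rcases le_total (t₀ + τ n) t with h' | h'
      · refine (late n _ _ _ _ hr (by omega) ?_ h').trans (le_trans ?_ hk.le)
        · linarith [hx.trans (min_le_right _ _), k.cast_nonneg (α := ℝ)]
        · exact one_div_le_one_div_of_le (by positivity) (by linarith)
      · refine (early n _ _ _ _ _ hr h'
          (hC _ _ _ _ hr (by omega) (hx.trans (min_le_left _ _))).le).trans ?_
        rwa [le_div_iff₀ (by positivity), mul_comm] at hη'
  exact ⟨a, a₂, β, ha, ha₂, hβ, fun t₀ x₀ t x hr => hw ⟨((t₀, x₀), (t, x)), hr⟩⟩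

end Decay

/-! ### The Lyapunov function -/

section Supremum

variable {X D : Type*} {f : ℕ → D → X → X} {g B : ℕ → X → ℝ}

/-- The supremum over all future states `y`, reachable at a time `s`, of `2 ^ (s - t) * g s y`. -/
noncomputable def weightedSup (f : ℕ → D → X → X) (g : ℕ → X → ℝ) (t : ℕ) (x : X) : ℝ :=
  sSup {r | ∃ s y, Reachable f t x s y ∧ r = 2 ^ (s - t) * g s y}

theorem weightedSup_le {t : ℕ} {x : X} {C : ℝ}
    (h : ∀ s y, Reachable f t x s y → 2 ^ (s - t) * g s y ≤ C) : weightedSup f g t x ≤ C := by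
  refine csSup_le ⟨_, t, x, .initial, rfl⟩ ?_
  rintro _ ⟨s, y, hr, rfl⟩
  exact h s y hr

/-- If `g` decays at rate `4`, then the tail of `weightedSup` decays at rate `2`. -/
theorem weighted_le_div (hB : ∀ t x s y, Reachable f t x s y → 4 ^ (s - t) * g s y ≤ B t x)
    {t s : ℕ} {x y : X} (hr : Reachable f t x s y) :
    2 ^ (s - t) * g s y ≤ B t x / 2 ^ (s - t) := by
  rw [le_div_iff₀ (by positivity)]
  refine le_trans (le_of_eq ?_) (hB _ _ _ _ hr)
  rw [show (4 : ℝ) = 2 * 2 by norm_num, mul_pow]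
  ring

variable (hg : ∀ t x, 0 ≤ g t x)
  (hB : ∀ t x s y, Reachable f t x s y → 4 ^ (s - t) * g s y ≤ B t x)

include hg hB

theorem weighted_le_of_reachable {t s : ℕ} {x y : X} (hr : Reachable f t x s y) :
    2 ^ (s - t) * g s y ≤ B t x :=
  (mul_le_mul_of_nonneg_right (pow_le_pow_left₀ (by norm_num) (by norm_num) _) (hg s y)).trans
    (hB _ _ _ _ hr)

theorem le_weightedSup {t s : ℕ} {x y : X} (hr : Reachable f t x s y) :
    2 ^ (s - t) * g s y ≤ weightedSup f g t x := by
  refine le_csSup ⟨B t x, ?_⟩ ⟨s, y, hr, rfl⟩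
  rintro _ ⟨s, y, hr, rfl⟩
  exact weighted_le_of_reachable hg hB hr

theorem self_le_weightedSup (t : ℕ) (x : X) : g t x ≤ weightedSup f g t x := by
  simpa using le_weightedSup hg hB (Reachable.initial (f := f) (t₀ := t) (x₀ := x))

theorem weightedSup_step_le (t : ℕ) (x : X) (d : D) :
    weightedSup f g (t + 1) (f t d x) ≤ 1 / 2 * weightedSup f g t x := by
  refine weightedSup_le fun s y hr => ?_
  have h := le_weightedSup hg hB (hr.head d)
  have hs : s - t = s - (t + 1) + 1 := by have := hr.le; omega
  rw [hs, pow_succ] at h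
  linarith

end Supremum

/-! ### Continuity of the Lyapunov function -/

section Continuity

variable {X Y D : Type*} [NormedAddCommGroup X] [NormedAddCommGroup Y] {f : ℕ → D → X → X}

theorem RegularOnBounded.continuous {H : ℕ → X → Y} (h : RegularOnBounded H) :
    Continuous fun p : ℕ × X => H p.1 p.2 := by
  refine continuous_prod_of_discrete_left.2 fun t => Metric.continuous_iff.2 fun x₀ ε hε => ?_
  obtain ⟨-, δ, hδ, hd⟩ := h {t} (Metric.ball x₀ 1) (finite_singleton t).isBounded
    Metric.isBounded_ball ε hε
  refine ⟨min δ 1, by positivity, fun x hx => ?_⟩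
  rw [dist_eq_norm]
  refine hd t rfl x (hx.trans_le (min_le_right _ _)) x₀ (Metric.mem_ball_self one_pos) ?_
  rw [← dist_eq_norm]
  exact hx.trans_le (min_le_left _ _)

theorem RegularOnBounded.classKInf_comp {H : ℕ → X → Y} (h : RegularOnBounded H) {a : ℝ → ℝ}
    (ha : ClassKInf a) : RegularOnBounded fun t x => a ‖H t x‖ := by
  intro I S hI hS ε hε
  obtain ⟨C, hC⟩ := (h I S hI hS 1 one_pos).1.exists_norm_le
  have hu : UniformContinuousOn a (Icc 0 C) :=
    isCompact_Icc.uniformContinuousOn_of_continuous (ha.continuousOn.mono Icc_subset_Ici_self)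
  obtain ⟨η, hη, hη'⟩ := Metric.uniformContinuousOn_iff.1 hu ε hε
  obtain ⟨-, δ, hδ, hd⟩ := h I S hI hS η hη
  refine ⟨isBounded_iff_forall_norm_le.2 ⟨a C, ?_⟩, δ, hδ, fun t ht x hx x₀ hx₀ hxx => ?_⟩
  · rintro _ ⟨t, ht, x, hx, rfl⟩
    rw [Real.norm_of_nonneg (ha.nonneg (norm_nonneg _))]
    exact ha.mono (norm_nonneg _) (hC _ ⟨t, ht, x, hx, rfl⟩)
  · refine hη' _ ⟨norm_nonneg _, hC _ ⟨t, ht, x, hx, rfl⟩⟩ _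
      ⟨norm_nonneg _, hC _ ⟨t, ht, x₀, hx₀, rfl⟩⟩ ?_
    rw [Real.dist_eq]
    exact (abs_norm_sub_norm_le _ _).trans_lt (hd t ht x hx x₀ hx₀ hxx)

theorem GrowthHypothesis.exists_state_le (hf : GrowthHypothesis f) (N : ℕ) (R : ℝ) :
    ∃ M, ∀ t₀ x₀ t x, Reachable f t₀ x₀ t x → t ≤ N → ‖x₀‖ ≤ R → ‖x‖ ≤ M := by
  obtain ⟨A, -, hA, -, hAN, -, h⟩ := hf.exists_norm_le
  exact ⟨A N R, fun t₀ x₀ t x hr ht hx => (h _ _ _ _ hr).trans ((hAN _ ht).trans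
    (hA N (norm_nonneg _) ((norm_nonneg _).trans hx) hx))⟩

/-- On a finite horizon the set of reachable states depends uniformly continuously on the initial
state: the same disturbance steers nearby states to nearby states. -/
theorem ContinuityHypothesis.exists_reachable_near (hc : ContinuityHypothesis f)
    (hf : GrowthHypothesis f) (N : ℕ) (R : ℝ) (k : ℕ) : ∀ ε, 0 < ε → ∃ δ, 0 < δ ∧
      ∀ t ≤ N, ∀ x x₀ : X, ‖x‖ ≤ R → ‖x₀‖ ≤ R → ‖x - x₀‖ < δ → ∀ s y, Reachable f t x s y →
        s ≤ t + k → ∃ y₀, Reachable f t x₀ s y₀ ∧ ‖y - y₀‖ < ε := by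
  induction k with
  | zero =>
    refine fun ε hε => ⟨ε, hε, fun t _ x x₀ _ _ hd s y hr hs => ?_⟩
    cases hr with
    | initial => exact ⟨x₀, .initial, hd⟩
    | step d hr => have := hr.le; omega
  | succ k ih =>
    intro ε hε
    obtain ⟨M, hM⟩ := hf.exists_state_le (N + k) R
    obtain ⟨-, η, hη, hfη⟩ := hc.1 (Metric.closedBall 0 M) (Iic (N + k))
      Metric.isBounded_closedBall (finite_Iic _).isBounded ε hε
    obtain ⟨δ, hδ, h⟩ := ih (min η ε) (by positivity)
    refine ⟨δ, hδ, fun t ht x x₀ hx hx₀ hd s y hr hs => ?_⟩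
    cases hr with
    | initial =>
      obtain ⟨y₀, hr₀, hy⟩ := h t ht x x₀ hx hx₀ hd _ _ .initial (by omega)
      exact ⟨y₀, hr₀, hy.trans_le (min_le_right _ _)⟩
    | @step s y d hr =>
      obtain ⟨y₀, hr₀, hy⟩ := h t ht x x₀ hx hx₀ hd _ _ hr (by omega)
      exact ⟨_, hr₀.step d, hfη s (mem_Iic.2 (by omega)) y
        (by simpa using hM _ _ _ _ hr (by omega) hx) y₀
        (by simpa using hM _ _ _ _ hr₀ (by omega) hx₀) (hy.trans_le (min_le_left _ _)) d⟩

/-- The far future contributes little to the supremum, uniformly on bounded sets, and the near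
future depends uniformly continuously on the state. -/
theorem ContinuityHypothesis.classCU_weightedSup (hc : ContinuityHypothesis f)
    (hf : GrowthHypothesis f) {g B : ℕ → X → ℝ} (hg : ∀ t x, 0 ≤ g t x)
    (hgr : RegularOnBounded g)
    (hB : ∀ t x s y, Reachable f t x s y → 4 ^ (s - t) * g s y ≤ B t x)
    (hBb : ∀ (N : ℕ) (R : ℝ), ∃ C, ∀ t ≤ N, ∀ x, ‖x‖ ≤ R → B t x ≤ C) :
    ClassCU (weightedSup f g) := by
  suffices h : RegularOnBounded (weightedSup f g) from ⟨h.continuous, h⟩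
  intro I S hI hS ε hε
  obtain ⟨N, hN⟩ := hI.bddAbove
  have hN : ∀ t ∈ I, t ≤ N := fun t ht => hN ht
  obtain ⟨R, hR⟩ := hS.exists_norm_le
  obtain ⟨C, hC⟩ := hBb N R
  refine ⟨isBounded_iff_forall_norm_le.2 ⟨C, ?_⟩, ?_⟩
  · rintro _ ⟨t, ht, x, hx, rfl⟩
    rw [Real.norm_of_nonneg ((hg t x).trans (self_le_weightedSup hg hB t x))]
    exact weightedSup_le fun s y hr =>
      (weighted_le_of_reachable hg hB hr).trans (hC t (hN t ht) x (hR x hx))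
  -- beyond `K` steps all contributions are at most `ε / 2`
  obtain ⟨K, hK⟩ := pow_unbounded_of_one_lt (C / (ε / 2)) (one_lt_two : (1 : ℝ) < 2)
  rw [div_lt_iff₀ (by positivity)] at hK
  obtain ⟨M, hM⟩ := hf.exists_state_le (N + K) R
  obtain ⟨-, η, hη, hgη⟩ := hgr (Iic (N + K)) (Metric.closedBall 0 M) (finite_Iic _).isBounded
    Metric.isBounded_closedBall (ε / 2 / 2 ^ K) (by positivity)
  obtain ⟨δ, hδ, hnear⟩ := hc.exists_reachable_near hf N R K η hη
  have key : ∀ t ∈ I, ∀ x ∈ S, ∀ x₀ ∈ S, ‖x - x₀‖ < δ →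
      weightedSup f g t x ≤ weightedSup f g t x₀ + ε / 2 := by
    intro t ht x hx x₀ hx₀ hd
    refine weightedSup_le fun s y hr => ?_
    rcases le_total s (t + K) with hs | hs
    · obtain ⟨y₀, hr₀, hy⟩ := hnear t (hN t ht) x x₀ (hR x hx) (hR x₀ hx₀) hd s y hr hs
      have hsN : s ≤ N + K := by have := hN t ht; omega
      have h1 := hgη s hsN y (by simpa using hM _ _ _ _ hr hsN (hR x hx)) y₀
        (by simpa using hM _ _ _ _ hr₀ hsN (hR x₀ hx₀)) hy
      have h2 : g s y ≤ g s y₀ + ε / 2 / 2 ^ K := by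
        linarith [(le_abs_self _).trans h1.le]
      have h3 : (2 : ℝ) ^ (s - t) ≤ 2 ^ K := pow_le_pow_right₀ (by norm_num) (by omega)
      calc (2 : ℝ) ^ (s - t) * g s y
          ≤ 2 ^ (s - t) * (g s y₀ + ε / 2 / 2 ^ K) :=
            mul_le_mul_of_nonneg_left h2 (by positivity)
        _ = 2 ^ (s - t) * g s y₀ + 2 ^ (s - t) * (ε / 2 / 2 ^ K) := mul_add _ _ _
        _ ≤ weightedSup f g t x₀ + 2 ^ K * (ε / 2 / 2 ^ K) :=
            add_le_add (le_weightedSup hg hB hr₀)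
              (mul_le_mul_of_nonneg_right h3 (by positivity))
        _ = weightedSup f g t x₀ + ε / 2 := by field_simp
    · have h1 : (2 : ℝ) ^ K ≤ 2 ^ (s - t) := pow_le_pow_right₀ (by norm_num) (by omega)
      have h2 : B t x / 2 ^ (s - t) ≤ ε / 2 := by
        rw [div_le_iff₀ (by positivity)]
        have h3 := mul_le_mul_of_nonneg_right h1 (half_pos hε).le
        linarith [hC t (hN t ht) x (hR x hx)]
      have h3 := (hg t x₀).trans (self_le_weightedSup hg hB t x₀)
      linarith [weighted_le_div hB hr]
  refine ⟨δ, hδ, fun t ht x hx x₀ hx₀ hd => ?_⟩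
  have h1 := key t ht x hx x₀ hx₀ hd
  have h2 := key t ht x₀ hx₀ x hx (by rwa [norm_sub_rev])
  rw [Real.norm_eq_abs, abs_lt]
  constructor <;> linarith

end Continuity

/-- Under the growth and output hypotheses attractivity yields a geometric Lyapunov function, which
is regular if the dynamics are. -/
theorem ReachableAttractivity.exists_geometricLyapunov {X Y D : Type*} [NormedAddCommGroup X]
    [NormedAddCommGroup Y] {f : ℕ → D → X → X} {H : ℕ → X → Y} (hf : GrowthHypothesis f)
    (hH : OutputHypothesis H) (h : ReachableAttractivity f H) :
    ∃ V, GeometricLyapunov f H V ∧ (ContinuityHypothesis f → ClassCU V) := by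
  obtain ⟨μ, hμ, hw⟩ := h.exists_weight hf
  have hHw := hH.norm_add_weight hμ
  obtain ⟨a₁, a₂, β, ha₁, ha₂, hβ, hB⟩ := hw.exists_geometric_decay hf hHw
  have hnorm : ∀ (t : ℕ) x, ‖‖H t x‖ + μ t * ‖x‖‖ = ‖H t x‖ + μ t * ‖x‖ := fun t x =>
    Real.norm_of_nonneg (add_nonneg (norm_nonneg _)
      (mul_nonneg (hμ.pos t t.cast_nonneg).le (norm_nonneg _)))
  have hg : ∀ (t : ℕ) x, 0 ≤ a₁ ‖‖H t x‖ + μ t * ‖x‖‖ := fun t x => ha₁.nonneg (norm_nonneg _)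
  refine ⟨weightedSup f fun t x => a₁ ‖‖H t x‖ + μ t * ‖x‖‖,
    ⟨fun t x => (hg t x).trans (self_le_weightedSup hg hB t x), a₁, a₂, β, μ, 1 / 2, ha₁, ha₂, hβ,
      hμ, by norm_num, by norm_num, fun t x => ⟨?_, ?_⟩, weightedSup_step_le hg hB⟩,
    fun hc => hc.classCU_weightedSup hf hg (hHw.1.classKInf_comp ha₁) hB fun N R => ?_⟩
  · simpa only [hnorm] using self_le_weightedSup hg hB t x
  · exact weightedSup_le fun s y hr => weighted_le_of_reachable hg hB hr
  · obtain ⟨b, hb⟩ := ((finite_Iic N).image fun n : ℕ => β n).bddAbove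
    refine ⟨a₂ (b * R), fun t ht x hx => ?_⟩
    have h0 := (hβ.pos t t.cast_nonneg).le
    have h1 : β t ≤ b := hb ⟨t, ht, rfl⟩
    exact ha₂.mono (mul_nonneg h0 (norm_nonneg _))
      (mul_le_mul h1 hx (norm_nonneg _) (h0.trans h1))

end OutputStability

theorem proposition2p2 {X Y D : Type*} [NormedAddCommGroup X] [NormedSpace ℝ X]
    [NormedAddCommGroup Y] [NormedSpace ℝ Y] (f : ℕ → D → X → X) (H : ℕ → X → Y)
    (h1 : OutputStability.GrowthHypothesis f) (h2 : OutputStability.OutputHypothesis H) :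
    [OutputStability.RGAOS f H,
      ∃ V : ℕ → X → ℝ, OutputStability.GeometricLyapunov f H V,
      ∃ V : ℕ → X → ℝ, OutputStability.PerturbedLyapunov f H V].TFAE ∧
    (OutputStability.ContinuityHypothesis f →
      (OutputStability.RGAOS f H ↔
        ∃ V : ℕ → X → ℝ, OutputStability.GeometricLyapunov f H V ∧ OutputStability.ClassCU V)) := by
  have necessity : OutputStability.RGAOS f H → ∃ V, OutputStability.GeometricLyapunov f H V ∧
      (OutputStability.ContinuityHypothesis f → OutputStability.ClassCU V) :=
    fun h => h.2.reachable.exists_geometricLyapunov h1 h2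
  have sufficiency : ∀ {V}, OutputStability.PerturbedLyapunov f H V → OutputStability.RGAOS f H :=
    fun h => h.reachableAttractivity.rgaos h1 h2
  refine ⟨?_, fun hc => ⟨fun h => ?_, fun ⟨V, hV, _⟩ => sufficiency hV.perturbed⟩⟩
  · tfae_have 1 → 2 := fun h => (necessity h).imp fun _ hV => hV.1
    tfae_have 2 → 3 := fun ⟨V, hV⟩ => ⟨V, hV.perturbed⟩
    tfae_have 3 → 1 := fun ⟨V, hV⟩ => sufficiency hV
    tfae_finish
  · exact (necessity h).imp fun _ hV => ⟨hV.1, hV.2 hc⟩
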